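/- Let $p,q\ge 3$ be integers, and let $\mathbb X$ be the sphere, the Euclidean plane or the hyperbolic plane according as $\frac1p+\frac1q-\frac12$ is positive, zero or negative. Let $F\subset\mathbb X$ be a triangle with angles $\frac\pi2,\frac\pi p,\frac\pi q$, and let $a,b,c$ be the reflections in the lines spanned by the sides of $F$ opposite to the angles $\frac\pi p,\frac\pi2,\frac\pi q$, respectively. Let $G_{p,q}=\langle a,b,c\rangle$ and let $\bar G_{p,q}=\langle ab,ac\rangle$ be its rotation subgroup. The triangles $fF$ ($f\in G_{p,q}$) tile $\mathbb X$. The regular tilings $(q^p)$ (by $q$-gons, $p$ at each vertex) and $(p^q)$ (by $p$-gons, $q$ at each vertex) and the Laves tiling $[p.q.p.q]$ (by quadrilaterals) consist of the images under $G_{p,q}$ of the tiles $$\bigcup_{w\in\langle a,b\rangle}wF,\qquad \bigcup_{w\in\langle b,c\rangle}wF,\qquad \bigcup_{w\in\langle a,c\rangle}wF,$$ respectively. A $k$-colouring of a tiling is a surjective map from its set of tiles to $\{1,\dots,k\}$; it is perfect with respect to $\bar G_{p,q}$ if for every $h\in\bar G_{p,q}$ there is a permutation $\pi_h$ of $\{1,\dots,k\}$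 such that, for every tile $t$, $ht$ is a tile whose colour is the image under $\pi_h$ of the colour of $t$. Let $S$ be a subgroup of $\bar G_{p,q}$ of finite index $k$, and let $r\in\{a,b,c\}$, so that $F\cup rF$ is a fundamental domain of $\bar G_{p,q}$. The left coset colouring given by $S$ and $r$ numbers the left cosets of $S$ in $\bar G_{p,q}$ as $S=S_1,\dots,S_k$ and gives both triangles $fF$ and $frF$ the colour $i$ whenever $f\in S_i$. We say that $S$ induces (by way of $r$) a perfect $k$-colouring of one of the three tilings if, for some such numbering, all triangles contained in a common tile have the same colour, and giving each tile the colour of its triangles is a $k$-colouring that is perfect with respect to $\bar G_{p,q}$. Then: 1. for $r\in\{a,b\}$, $S$ induces a perfect $k$-colouring of $(q^p)$ if and only if $ab\in S$; 2. for $r\in\{a,c\}$, $S$ induces a perfect $k$-colouring of $[p.q.p.q]$ if and only if $ac\in S$; 3. for $r\in\{b,c\}$, $S$ induces a perfect $k$-colouring of $(p^q)$ if and only if $bc\in S$. -/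

import Mathlib

noncomputable section

namespace RegTiling

/-! ### The sphere, the Euclidean plane and the hyperbolic plane

For `ε = 1, 0, -1` the set `Plane ε ⊆ ℝ³` is, respectively, the unit sphere
`x₀² + x₁² + x₂² = 1`, the affine plane `x₂ = 1`, and the upper sheet `x₂ > 0` of the hyperboloid
`x₀² + x₁² - x₂² = -1`. -/

/-- The model plane of curvature `ε` (used for `ε = 1, 0, -1`). -/
def Plane (ε : ℝ) : Type :=
  {x : Fin 3 → ℝ // ε * (x 0 ^ 2 + x 1 ^ 2) + x 2 ^ 2 = 1 ∧ (ε ≤ 0 → 0 < x 2)}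

/-- Pairing of a covector with a vector. -/
def pair (n x : Fin 3 → ℝ) : ℝ := n 0 * x 0 + n 1 * x 1 + n 2 * x 2

/-- The squared chord length of two points: it determines the distance, being `(2 sin (d/2))²` on
the sphere, `d²` in the Euclidean plane and `(2 sinh (d/2))²` in the hyperbolic plane. -/
def quadrance {ε : ℝ} (x y : Plane ε) : ℝ :=
  (x.1 0 - y.1 0) ^ 2 + (x.1 1 - y.1 1) ^ 2 + ε * (x.1 2 - y.1 2) ^ 2

/-- The symmetric bilinear form on covectors. For unit covectors `m`, `n`, the half planes
`pair m x ≥ 0` and `pair n x ≥ 0` meet in the angle `θ` with `cos θ = - coForm ε m n`. -/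
def coForm (ε : ℝ) (m n : Fin 3 → ℝ) : ℝ := m 0 * n 0 + m 1 * n 1 + ε * (m 2 * n 2)

/-- The map `x ↦ x - 2 ⟨n, x⟩ n♯`, for a unit covector `n` the reflection in the line
`⟨n, x⟩ = 0`. -/
def reflFun (ε : ℝ) (n x : Fin 3 → ℝ) : Fin 3 → ℝ :=
  ![x 0 - 2 * pair n x * n 0, x 1 - 2 * pair n x * n 1, x 2 - 2 * pair n x * (ε * n 2)]

theorem reflFun_mem {ε : ℝ} {n : Fin 3 → ℝ} (hn : coForm ε n n = 1) (x : Plane ε) :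
    ε * (reflFun ε n x.1 0 ^ 2 + reflFun ε n x.1 1 ^ 2) + reflFun ε n x.1 2 ^ 2 = 1 ∧
      (ε ≤ 0 → 0 < reflFun ε n x.1 2) := by
  obtain ⟨x, h1, h2⟩ := x
  simp only [coForm] at hn
  simp only [reflFun, pair, Matrix.cons_val]
  refine ⟨?_, fun hε => ?_⟩
  · linear_combination h1 + 4 * ε * (n 0 * x 0 + n 1 * x 1 + n 2 * x 2) ^ 2 * hn
  · have hx := h2 hε
    set u := n 0 * x 0 + n 1 * x 1 with hu
    set m := -ε * n 2 ^ 2 with hm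
    have hm0 : 0 ≤ m := mul_nonneg (by linarith) (sq_nonneg _)
    have hcs : u ^ 2 ≤ (1 + m) * (x 0 ^ 2 + x 1 ^ 2) := by
      have : (1 + m) = n 0 ^ 2 + n 1 ^ 2 := by rw [hm]; linear_combination -hn
      rw [this, hu]; nlinarith [sq_nonneg (n 0 * x 1 - n 1 * x 0)]
    have hsq : (2 * ε * n 2 * u) ^ 2 < ((1 + 2 * m) * x 2) ^ 2 := by
      have e1 : (2 * ε * n 2 * u) ^ 2 = 4 * m * (-ε) * u ^ 2 := by rw [hm]; ring
      have e2 : 4 * m * (-ε) * u ^ 2 ≤ 4 * m * (-ε) * ((1 + m) * (x 0 ^ 2 + x 1 ^ 2)) :=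
        mul_le_mul_of_nonneg_left hcs (mul_nonneg (by linarith) (by linarith))
      have e3 : 4 * m * (-ε) * ((1 + m) * (x 0 ^ 2 + x 1 ^ 2)) = 4 * m * (1 + m) * (x 2 ^ 2 - 1) := by
        linear_combination (-4 * m * (1 + m)) * h1
      nlinarith [mul_nonneg hm0 hm0, pow_pos hx 2]
    have hlt := abs_lt_of_sq_lt_sq hsq (by positivity)
    have := (abs_lt.1 hlt).2
    have e : x 2 - 2 * (u + n 2 * x 2) * (ε * n 2) = (1 + 2 * m) * x 2 - 2 * ε * n 2 * u := by
      rw [hm]; ring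
    rw [e]; linarith

theorem reflFun_reflFun {ε : ℝ} {n : Fin 3 → ℝ} (hn : coForm ε n n = 1) (x : Fin 3 → ℝ) :
    reflFun ε n (reflFun ε n x) = x := by
  simp only [coForm] at hn
  ext i
  fin_cases i <;> simp only [reflFun, pair, Matrix.cons_val, Fin.zero_eta, Fin.mk_one, Fin.reduceFinMk]
  · linear_combination 4 * n 0 * (n 0 * x 0 + n 1 * x 1 + n 2 * x 2) * hn
  · linear_combination 4 * n 1 * (n 0 * x 0 + n 1 * x 1 + n 2 * x 2) * hn
  · linear_combination 4 * ε * n 2 * (n 0 * x 0 + n 1 * x 1 + n 2 * x 2) * hn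

/-- The reflection of the model plane in the line `⟨n, x⟩ = 0`. -/
def refl {ε : ℝ} (n : Fin 3 → ℝ) (hn : coForm ε n n = 1) : Equiv.Perm (Plane ε) where
  toFun x := ⟨reflFun ε n x.1, reflFun_mem hn x⟩
  invFun x := ⟨reflFun ε n x.1, reflFun_mem hn x⟩
  left_inv x := Subtype.ext (reflFun_reflFun hn x.1)
  right_inv x := Subtype.ext (reflFun_reflFun hn x.1)

/-- Reflections are isometries. -/
theorem quadrance_refl {ε : ℝ} (hε : ε = 1 ∨ ε = 0 ∨ ε = -1) (n : Fin 3 → ℝ)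
    (hn : coForm ε n n = 1) (x y : Plane ε) :
    quadrance (refl n hn x) (refl n hn y) = quadrance x y := by
  have h : ∀ z : Plane ε, (refl n hn z).1 = reflFun ε n z.1 := fun _ => rfl
  simp only [quadrance, h, reflFun, pair, Matrix.cons_val]
  simp only [coForm] at hn
  have hxy : (1 - ε ^ 2) * (x.1 2 - y.1 2) = 0 := by
    rcases hε with rfl | rfl | rfl
    · ring
    · have e : ∀ z : Plane 0, z.1 2 = 1 := fun z => by
        have h1 := z.2.1
        have h2 := z.2.2 le_rfl
        nlinarith
      rw [e x, e y]; ring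
    · ring
  have he : ε ^ 3 = ε := by rcases hε with rfl | rfl | rfl <;> norm_num
  set u := n 0 * (x.1 0 - y.1 0) + n 1 * (x.1 1 - y.1 1) + n 2 * (x.1 2 - y.1 2) with hu
  linear_combination 4 * u ^ 2 * hn + 4 * u ^ 2 * n 2 ^ 2 * he + 4 * u * n 2 * hxy

/-! ### The triangle `F` with angles `π/2`, `π/p`, `π/q` and the reflections in its sides -/

/-- `1 - cos² (π/p) - cos² (π/q)`, the determinant of the Gram matrix of the triangle. -/
def gram (p q : ℕ) : ℝ := 1 - Real.cos (Real.pi / q) ^ 2 - Real.cos (Real.pi / p) ^ 2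

/-- The curvature `1`, `0` or `-1` of the plane that is tiled. -/
def curv (p q : ℕ) : ℝ := Real.sign (gram p q)

/-- The curvature is the sign of `1/p + 1/q - 1/2`. -/
theorem curv_eq {p q : ℕ} (hp : 3 ≤ p) (hq : 3 ≤ q) :
    curv p q = Real.sign (1 / (p : ℝ) + 1 / (q : ℝ) - 1 / 2) := by
  have hp' : (3 : ℝ) ≤ p := by exact_mod_cast hp
  have hq' : (3 : ℝ) ≤ q := by exact_mod_cast hq
  have hπ := Real.pi_pos
  have key : ∀ m : ℝ, 3 ≤ m → 0 < Real.pi / m ∧ Real.pi / m ≤ Real.pi / 3 := fun m hm =>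
    ⟨div_pos hπ (by linarith), div_le_div_of_nonneg_left hπ.le (by norm_num) hm⟩
  obtain ⟨hα0, hα1⟩ := key p hp'
  obtain ⟨hβ0, hβ1⟩ := key q hq'
  have hsum : 1 / (p : ℝ) + 1 / (q : ℝ) - 1 / 2
      = (Real.pi / p + Real.pi / q - Real.pi / 2) / Real.pi := by field_simp
  have hg : gram p q = -(Real.cos (Real.pi / p + Real.pi / q)) *
      Real.cos (Real.pi / p - Real.pi / q) := by
    rw [gram, Real.cos_add, Real.cos_sub]
    linear_combination (-Real.sin (Real.pi / q) ^ 2) * Real.sin_sq_add_cos_sq (Real.pi / p)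
      + (Real.cos (Real.pi / p) ^ 2 - 1) * Real.sin_sq_add_cos_sq (Real.pi / q)
  have hd : 0 < Real.cos (Real.pi / p - Real.pi / q) :=
    Real.cos_pos_of_mem_Ioo ⟨by linarith, by linarith⟩
  rw [curv, hsum, hg]
  rcases lt_trichotomy (Real.pi / p + Real.pi / q) (Real.pi / 2) with h | h | h
  · have hc : 0 < Real.cos (Real.pi / p + Real.pi / q) :=
      Real.cos_pos_of_mem_Ioo ⟨by linarith, h⟩
    rw [Real.sign_of_neg (mul_neg_of_neg_of_pos (by linarith) hd),
      Real.sign_of_neg (div_neg_of_neg_of_pos (by linarith) hπ)]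
  · rw [h]; simp
  · have hc : Real.cos (Real.pi / p + Real.pi / q) < 0 :=
      Real.cos_neg_of_pi_div_two_lt_of_lt h (by linarith)
    rw [Real.sign_of_pos (mul_pos (by linarith) hd),
      Real.sign_of_pos (div_pos (by linarith) hπ)]

/-- The sphere, the Euclidean plane or the hyperbolic plane, according to `p` and `q`. -/
abbrev X (p q : ℕ) : Type := Plane (curv p q)

/-- The third coordinate of the covector of the hypotenuse (in the Euclidean case, where it fixes
the size of the triangle, it is taken to be `1`). -/
def height (p q : ℕ) : ℝ := if gram p q = 0 then 1 else √|gram p q|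

/-- The side opposite to the angle `π/p`. -/
def normA : Fin 3 → ℝ := ![1, 0, 0]

/-- The side opposite to the right angle. -/
def normB (p q : ℕ) : Fin 3 → ℝ :=
  ![-Real.cos (Real.pi / q), -Real.cos (Real.pi / p), height p q]

/-- The side opposite to the angle `π/q`. -/
def normC : Fin 3 → ℝ := ![0, 1, 0]

theorem coForm_normA (ε : ℝ) : coForm ε normA normA = 1 := by simp [coForm, normA]

theorem coForm_normC (ε : ℝ) : coForm ε normC normC = 1 := by simp [coForm, normC]

theorem coForm_normB (p q : ℕ) : coForm (curv p q) (normB p q) (normB p q) = 1 := by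
  have h : curv p q * (height p q * height p q) = gram p q := by
    unfold curv height
    rcases lt_trichotomy (gram p q) 0 with h | h | h
    · rw [if_neg h.ne, Real.mul_self_sqrt (abs_nonneg _), Real.sign_of_neg h, abs_of_neg h]; ring
    · simp [h]
    · rw [if_neg h.ne', Real.mul_self_sqrt (abs_nonneg _), Real.sign_of_pos h, abs_of_pos h]; ring
  simp only [coForm, normB, Matrix.cons_val]
  rw [h, gram]; ring

/-- The triangle has the angles `π/q` (sides `a`, `b`), `π/2` (sides `a`, `c`), `π/p`
(sides `b`, `c`). -/
theorem coForm_angles (p q : ℕ) :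
    coForm (curv p q) normA (normB p q) = -Real.cos (Real.pi / q) ∧
    coForm (curv p q) normA normC = -Real.cos (Real.pi / 2) ∧
    coForm (curv p q) (normB p q) normC = -Real.cos (Real.pi / p) := by
  simp [coForm, normA, normB, normC]

/-- The right-angled triangle `F`. -/
def F (p q : ℕ) : Set (X p q) :=
  {x | 0 ≤ pair normA x.1 ∧ 0 ≤ pair (normB p q) x.1 ∧ 0 ≤ pair normC x.1}

/-- The reflection in the side opposite to the angle `π/p`. -/
def a (p q : ℕ) : Equiv.Perm (X p q) := refl normA (coForm_normA _)

/-- The reflection in the side opposite to the right angle. -/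
def b (p q : ℕ) : Equiv.Perm (X p q) := refl (normB p q) (coForm_normB p q)

/-- The reflection in the side opposite to the angle `π/q`. -/
def c (p q : ℕ) : Equiv.Perm (X p q) := refl normC (coForm_normC _)

/-! ### The groups -/

/-- The group generated by the three reflections. -/
def G (p q : ℕ) : Subgroup (Equiv.Perm (X p q)) := Subgroup.closure {a p q, b p q, c p q}

/-- The rotation group, generated by `ab` and `ac`. -/
def rotG (p q : ℕ) : Subgroup (Equiv.Perm (X p q)) :=
  Subgroup.closure {a p q * b p q, a p q * c p q}

theorem b_mul_b (p q : ℕ) : b p q * b p q = 1 :=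
  Equiv.ext fun x => Subtype.ext (reflFun_reflFun (coForm_normB p q) x.1)

/-- The rotation `ab` about the vertex of `F` with angle `π/q`. -/
def ab (p q : ℕ) : rotG p q := ⟨a p q * b p q, Subgroup.subset_closure (Or.inl rfl)⟩

/-- The rotation `ac` about the vertex of `F` with the right angle. -/
def ac (p q : ℕ) : rotG p q := ⟨a p q * c p q, Subgroup.subset_closure (Or.inr rfl)⟩

/-- The rotation `bc` about the vertex of `F` with angle `π/p`. -/
def bc (p q : ℕ) : rotG p q := ⟨b p q * c p q, by
  have h : b p q * c p q = ((ab p q)⁻¹ * ac p q : rotG p q) := by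
    have hb : (b p q)⁻¹ = b p q := inv_eq_of_mul_eq_one_left (b_mul_b p q)
    simp [ab, ac, mul_assoc, hb]
  rw [h]; exact SetLike.coe_mem _⟩

/-! ### The tilings -/

/-- The tiling `T_{p,q}` by the triangles `f F`, `f ∈ G`. -/
def triangles (p q : ℕ) : Set (Set (X p q)) := {Δ | ∃ f ∈ G p q, Δ = f '' F p q}

/-- The polygon made of the triangles `w F`, where `w` runs through the (dihedral) group generated
by the reflections `r` and `s`. -/
def polygon (p q : ℕ) (r s : Equiv.Perm (X p q)) : Set (X p q) :=
  ⋃ w ∈ Subgroup.closure {r, s}, w '' F p q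

/-- The tiling by the images of this polygon under `G`. -/
def tilingOf (p q : ℕ) (r s : Equiv.Perm (X p q)) : Set (Set (X p q)) :=
  {t | ∃ g ∈ G p q, t = g '' polygon p q r s}

/-- The regular tiling `(q^p)`: each tile is a regular `q`-gon, made of the `2q` triangles around a
vertex with angle `π/q`. -/
def tilingQP (p q : ℕ) : Set (Set (X p q)) := tilingOf p q (a p q) (b p q)

/-- The Laves tiling `[p.q.p.q]`: each tile is a quadrilateral, made of the four triangles around a
vertex with angle `π/2`; its edges join the centres of the `p`-gons of `(p^q)` to their vertices. -/
def tilingLaves (p q : ℕ) : Set (Set (X p q)) := tilingOf p q (a p q) (c p q)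

/-- The regular tiling `(p^q)`: each tile is a regular `p`-gon, made of the `2p` triangles around a
vertex with angle `π/p`. -/
def tilingPQ (p q : ℕ) : Set (Set (X p q)) := tilingOf p q (b p q) (c p q)

/-! ### Colourings -/

variable {p q k : ℕ}

/-- `(h, π)` is a colour symmetry of the coloured tiling `(𝒯, col)`: `h` maps tiles to tiles and
permutes the colours by `π`. -/
def IsColourSymmetry {𝒯 : Set (Set (X p q))} (col : 𝒯 → Fin k) (h : Equiv.Perm (X p q))
    (π : Equiv.Perm (Fin k)) : Prop :=
  ∀ t : 𝒯, ∃ ht : h '' t.1 ∈ 𝒯, col ⟨h '' t.1, ht⟩ = π (col t)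

/-- `col` is a `k`-colouring of `𝒯` that is perfect with respect to the rotation group. -/
def IsPerfectColouring {𝒯 : Set (Set (X p q))} (col : 𝒯 → Fin k) : Prop :=
  Function.Surjective col ∧
    ∀ h ∈ rotG p q, ∃ π : Equiv.Perm (Fin k), IsColourSymmetry col h π

/-- `γ` is a left coset colouring of the triangles by the subgroup `S` of the rotation group, with
respect to the fundamental domain `F ∪ r F` of the rotation group (`r` one of `a`, `b`, `c`): for
some numbering `e` of the left cosets of `S`, starting with `S` itself, both triangles in
`f (F ∪ r F)` get the number of the coset `f S`. -/
def IsLeftCosetColouring (S : Subgroup (rotG p q)) (r : Equiv.Perm (X p q))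
    (γ : triangles p q → Fin k) : Prop :=
  ∃ e : (rotG p q ⧸ S) ≃ Fin k, (e ((1 : rotG p q) : rotG p q ⧸ S) : ℕ) = 0 ∧
    ∀ (f : rotG p q) (Δ : triangles p q),
      Δ.1 = f.1 '' F p q ∨ Δ.1 = f.1 '' (r '' F p q) → γ Δ = e (f : rotG p q ⧸ S)

/-- `S` induces, by way of the fundamental domain `F ∪ r F`, a `k`-colouring of `𝒯` that is perfect
with respect to the rotation group: in the left coset colouring, all the triangles that form a tile
have the same colour, and giving the tile this colour is such a colouring. -/
def InducesPerfect (S : Subgroup (rotG p q)) (r : Equiv.Perm (X p q)) (k : ℕ)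
    (𝒯 : Set (Set (X p q))) : Prop :=
  ∃ (γ : triangles p q → Fin k) (col : 𝒯 → Fin k),
    IsLeftCosetColouring S r γ ∧
    (∀ (t : 𝒯) (Δ : triangles p q), Δ.1 ⊆ t.1 → col t = γ Δ) ∧
    IsPerfectColouring col

end RegTiling

end

/-! ### Tits' theorem on the fundamental chamber of a Coxeter group -/

/-! Write `r` and `s` for the two reflections that generate the dihedral group of a tile. The
triangle `g F` has the colour of the coset `g S` or `g r S`, according to which of `g`, `g r` is a
rotation. In either case the cosets of the neighbours `g F` and `g s F` differ by the factor `s r`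
on the right, while `g F` and `g r F` always agree. So the tiles are monochromatic exactly if `s r ∈
S` (`cosetOf_mul_gen`, `mem_of_inducesPerfect`). Perfection then costs nothing: rotations permute
the left cosets by left multiplication (`cosetOf_mul_left`), and every coset is the colour of some
tile.

The real work is to show that this colouring is well defined: different elements of `G` give
different triangles, a triangle inside a tile is one of those that make it up, and no generating
reflection is a rotation. All three come from Tits' theorem that a Coxeter group moves the open
fundamental chamber off the closed one (`eq_one_of_mem_chamber`). It applies to the three geometries
at once, since the covectors of the sides of `F` have the Gram matrix `-cos (π / M i j)` and so
behave as simple roots (`eq_one_of_action_mem`). -/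

namespace CoxeterSystem

variable {B W Y : Type*} [Group W] {M : CoxeterMatrix B} (cs : CoxeterSystem M W)

/-- The functions `l i` stand for simple roots; `hl` is all that is needed of linearity. The two
generators act on the combinations of `l i` and `l j` as a dihedral group, so the coefficients obey
the recurrence of `sin (n θ)`. The factor `sin θ` on the left avoids a division. -/
theorem apply_alternatingWord_inv (φ : W →* Equiv.Perm Y) (l : B → Y → ℝ)
    (hl : ∀ i j y, l i (φ (cs.simple j) y) = l i y + 2 * Real.cos (Real.pi / M i j) * l j y)
    (i j : B) (n : ℕ) (y : Y) :
    l i (φ (cs.wordProd (alternatingWord i j n))⁻¹ y) * Real.sin (Real.pi / M i j) =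
      if Even n then
        Real.sin ((n + 1) * (Real.pi / M i j)) * l i y + Real.sin (n * (Real.pi / M i j)) * l j y
      else
        Real.sin (n * (Real.pi / M i j)) * l i y +
          Real.sin ((n + 1) * (Real.pi / M i j)) * l j y := by
  have hself : ∀ i y, l i (φ (cs.simple i) y) = -l i y := fun i y => by
    rw [hl, M.diagonal]; simp; ring
  have hrec : ∀ x θ : ℝ, Real.sin ((x + 1 + 1) * θ) =
      2 * Real.cos θ * Real.sin ((x + 1) * θ) - Real.sin (x * θ) := fun x θ => by
    have h1 : (x + 1 + 1) * θ = (x + 1) * θ + θ := by ring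
    have h2 : x * θ = (x + 1) * θ - θ := by ring
    rw [h1, h2, Real.sin_add, Real.sin_sub]; ring
  induction n generalizing y with
  | zero => simp [alternatingWord]; ring
  | succ n ih =>
    rw [alternatingWord_succ', wordProd_cons, mul_inv_rev, inv_simple, map_mul,
      Equiv.Perm.mul_apply, ih]
    have hs := hl j i y
    rw [M.symmetric] at hs
    by_cases hn : Even n
    · have hn' : ¬ Even (n + 1) := by simpa [Nat.even_add_one] using hn
      simp only [hn, hn', if_true, if_false, hl i j, hself]
      push_cast
      rw [hrec]; ring
    · have hn' : Even (n + 1) := by simpa [Nat.even_add_one] using hn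
      simp only [hn, hn', if_true, if_false, hs, hself]
      push_cast
      rw [hrec]; ring

/-- An element `w` that is not shortened by `s i` moves the open fundamental chamber to the positive
side of the wall of `i`. -/
theorem pos_of_not_isRightDescent (hM : ∀ i j, M i j ≠ 0) (φ : W →* Equiv.Perm Y) (l : B → Y → ℝ)
    (hl : ∀ i j y, l i (φ (cs.simple j) y) = l i y + 2 * Real.cos (Real.pi / M i j) * l j y)
    {x : Y} (hx : ∀ i, 0 < l i x) (w : W) (i : B) (hw : ¬ cs.IsRightDescent w i) :
    0 < l i (φ w⁻¹ x) := by
  classical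
  induction hn : cs.length w using Nat.strong_induction_on generalizing w i with
  | _ n ih =>
  subst hn
  by_cases hw1 : w = 1
  · simpa [hw1] using hx i
  obtain ⟨j, hj⟩ := cs.exists_rightDescent_of_ne_one hw1
  have hij : i ≠ j := by rintro rfl; exact hw hj
  -- the longest alternating suffix in `i`, `j` of a reduced word for `w`
  let P : ℕ → Prop := fun m =>
    cs.length (w * (cs.wordProd (alternatingWord i j m))⁻¹) + m = cs.length w
  have hP1 : P 1 := by
    simpa [P, alternatingWord] using cs.isRightDescent_iff.1 hj
  have hle : 1 ≤ cs.length w := by have := hP1; simp only [P] at this; omega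
  obtain ⟨m, hm⟩ : ∃ m, m = Nat.findGreatest P (cs.length w) := ⟨_, rfl⟩
  have hPm : P m := hm ▸ Nat.findGreatest_spec hle hP1
  have hm1 : 1 ≤ m := hm ▸ Nat.le_findGreatest hle hP1
  have hmax : ¬ P (m + 1) := fun h => by
    have hb : m + 1 ≤ cs.length w := by simp only [P] at h; omega
    have := Nat.le_findGreatest hb h
    omega
  set u := cs.wordProd (alternatingWord i j m) with hu
  set v := w * u⁻¹ with hv
  have hwv : w = v * u := by simp [hv]
  replace hPm : cs.length v + m = cs.length w := hPm
  -- A descent of `v` at the letter that would extend the suffix contradicts its maximality.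
  have hnext : ∀ k, k = (if Even m then j else i) → ¬ cs.IsRightDescent v k := by
    intro k hk h
    apply hmax
    simp only [P]
    rw [alternatingWord_succ', ← hk, wordProd_cons, ← hu, mul_inv_rev, inv_simple, ← mul_assoc,
      ← hv]
    have := cs.isRightDescent_iff.1 h
    omega
  -- Here `k` is the first letter of `u`. A descent of `v` at `k` would write `w` as `(v s_k) (s_k
  -- u)`, with fewer letters than its length.
  have hprev : ∀ k, k = (if Even m then i else j) → ¬ cs.IsRightDescent v k := by
    intro k hk h
    obtain ⟨m', hm'⟩ := Nat.exists_eq_add_of_le' hm1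
    have hu' : cs.simple k * u = cs.wordProd (alternatingWord i j m') := by
      have hk' : k = if Even m' then j else i := by
        rw [hk, hm']; simp only [Nat.even_add_one]; split_ifs <;> rfl
      rw [hu, hm', alternatingWord_succ', ← hk', wordProd_cons, simple_mul_simple_cancel_left]
    have h1 : w = v * cs.simple k * cs.wordProd (alternatingWord i j m') := by
      rw [← hu', mul_assoc, simple_mul_simple_cancel_left, ← hwv]
    have h2 := cs.length_mul_le (v * cs.simple k) (cs.wordProd (alternatingWord i j m'))
    have h3 := cs.length_wordProd_le (alternatingWord i j m')
    rw [length_alternatingWord] at h3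
    rw [← h1] at h2
    have := cs.isRightDescent_iff.1 h
    omega
  have hvi : 0 < l i (φ v⁻¹ x) := by
    refine ih _ (by omega) v i ?_ rfl
    by_cases he : Even m
    · exact hprev i (by simp [he])
    · exact hnext i (by simp [he])
  have hvj : 0 < l j (φ v⁻¹ x) := by
    refine ih _ (by omega) v j ?_ rfl
    by_cases he : Even m
    · exact hnext j (by simp [he])
    · exact hprev j (by simp [he])
  -- For `m ≥ M i j` the alternating word of `u s_i` is not reduced, so `w s_i = v (u s_i)` is no
  -- longer than `w`, and `i` is a descent after all.
  have hmM : m < M i j := by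
    by_contra! hge
    apply hw
    have hred : ¬ cs.IsReduced (alternatingWord j i (m + 1)) :=
      cs.not_isReduced_alternatingWord j i (hM j i) (by rw [M.symmetric]; omega)
    have h1 : cs.wordProd (alternatingWord j i (m + 1)) = u * cs.simple i := by
      rw [alternatingWord_succ, wordProd_concat]
    have h2 := cs.length_wordProd_le (alternatingWord j i (m + 1))
    have h3 : cs.length (cs.wordProd (alternatingWord j i (m + 1))) ≠
        (alternatingWord j i (m + 1)).length := hred
    rw [length_alternatingWord, h1] at h2 h3
    have h4 := cs.length_mul_le v (u * cs.simple i)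
    rw [← mul_assoc, ← hwv] at h4
    rw [IsRightDescent]
    have h5 := cs.length_mul_simple_ne w i
    omega
  have hM0 : (0 : ℝ) < M i j := by exact_mod_cast Nat.pos_of_ne_zero (hM i j)
  have hM2 : (1 : ℝ) < M i j := by
    have := hM i j
    have := M.off_diagonal i j hij
    exact_mod_cast (by omega : 1 < M i j)
  have hθ : 0 < Real.pi / M i j := div_pos Real.pi_pos hM0
  have hsin : 0 < Real.sin (Real.pi / M i j) :=
    Real.sin_pos_of_pos_of_lt_pi hθ (div_lt_self Real.pi_pos hM2)
  have hmR : (m : ℝ) + 1 ≤ M i j := by exact_mod_cast hmM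
  have hs0 : 0 < Real.sin (m * (Real.pi / M i j)) := by
    refine Real.sin_pos_of_pos_of_lt_pi (mul_pos (by exact_mod_cast hm1) hθ) ?_
    rw [mul_div_assoc', div_lt_iff₀ hM0, mul_comm]
    exact mul_lt_mul_of_pos_left (by linarith) Real.pi_pos
  have hs1 : 0 ≤ Real.sin ((m + 1) * (Real.pi / M i j)) := by
    refine Real.sin_nonneg_of_nonneg_of_le_pi (by positivity) ?_
    rw [mul_div_assoc', div_le_iff₀ hM0, mul_comm]
    exact mul_le_mul_of_nonneg_left hmR Real.pi_pos.le
  -- As `1 ≤ m < M i j`, the value of `l i` at `w⁻¹ x` is a combination of two positive numbers with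
  -- one positive and one nonnegative coefficient.
  have key := cs.apply_alternatingWord_inv φ l hl i j m (φ v⁻¹ x)
  rw [← hu, ← Equiv.Perm.mul_apply, ← map_mul, ← mul_inv_rev, ← hwv] at key
  refine pos_of_mul_pos_left ?_ hsin.le
  rw [key]
  split_ifs <;> positivity

/-- The translates of the open fundamental chamber are disjoint from the closed one. -/
theorem eq_one_of_mem_chamber (hM : ∀ i j, M i j ≠ 0) (φ : W →* Equiv.Perm Y) (l : B → Y → ℝ)
    (hl : ∀ i j y, l i (φ (cs.simple j) y) = l i y + 2 * Real.cos (Real.pi / M i j) * l j y)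
    {x : Y} (hx : ∀ i, 0 < l i x) (w : W) (hw : ∀ i, 0 ≤ l i (φ w x)) : w = 1 := by
  by_contra h
  obtain ⟨i, hi⟩ := cs.exists_rightDescent_of_ne_one (inv_ne_one.2 h)
  -- If `w⁻¹` is shortened by `s i`, then `w⁻¹ s_i` is not, so `l i` is positive at `s_i w x`, hence
  -- negative at `w x`.
  have hpos := cs.pos_of_not_isRightDescent hM φ l hl hx (w⁻¹ * cs.simple i) i
    (cs.isRightDescent_iff_not_isRightDescent_mul.1 hi)
  rw [mul_inv_rev, inv_simple, inv_inv, map_mul, Equiv.Perm.mul_apply, hl, M.diagonal] at hpos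
  have := hw i
  simp at hpos
  linarith

end CoxeterSystem

noncomputable section

namespace RegTiling

/-! ### The reflection group as a Coxeter group -/

theorem refl_mul_refl {ε : ℝ} {n : Fin 3 → ℝ} (hn : coForm ε n n = 1) :
    refl n hn * refl n hn = 1 :=
  Equiv.ext fun x => Subtype.ext (reflFun_reflFun hn x.1)

theorem pair_refl {ε : ℝ} (m n : Fin 3 → ℝ) (hn : coForm ε n n = 1) (x : Plane ε) :
    pair m (refl n hn x).1 = pair m x.1 - 2 * coForm ε m n * pair n x.1 := by
  have h : (refl n hn x).1 = reflFun ε n x.1 := rfl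
  simp only [h, pair, reflFun, coForm, Matrix.cons_val]
  ring

/-- The determinant of the vectors dual to the covectors `m`, `n`, and `x`; it is invariant under
the reflections in `m` and `n`. -/
def rotInvariant (ε : ℝ) (m n x : Fin 3 → ℝ) : ℝ :=
  (m 1 * (ε * n 2) - ε * m 2 * n 1) * x 0 + (ε * m 2 * n 0 - m 0 * (ε * n 2)) * x 1 +
    (m 0 * n 1 - m 1 * n 0) * x 2

theorem rotInvariant_refl_mul_refl {ε : ℝ} (m n : Fin 3 → ℝ) (hm : coForm ε m m = 1)
    (hn : coForm ε n n = 1) (x : Plane ε) :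
    rotInvariant ε m n ((refl m hm * refl n hn) x).1 = rotInvariant ε m n x.1 := by
  have h : ((refl m hm * refl n hn) x).1 = reflFun ε m (reflFun ε n x.1) := rfl
  simp only [h, rotInvariant, reflFun, Matrix.cons_val]
  ring

/-- The three functionals have determinant `sin² θ`, the Gram determinant of `m` and `n`, so
Cramer's rule recovers the coordinates. This holds for every `ε`, including the degenerate form `ε =
0`. -/
theorem eq_of_pair_eq_of_rotInvariant_eq {ε θ : ℝ} (m n : Fin 3 → ℝ) (hm : coForm ε m m = 1)
    (hn : coForm ε n n = 1) (hmn : coForm ε m n = -Real.cos θ) (hθ : Real.sin θ ≠ 0)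
    {x y : Plane ε} (h1 : pair m x.1 = pair m y.1) (h2 : pair n x.1 = pair n y.1)
    (h3 : rotInvariant ε m n x.1 = rotInvariant ε m n y.1) : x = y := by
  have hdet : (m 1 * n 2 - m 2 * n 1) * (m 1 * (ε * n 2) - ε * m 2 * n 1) +
      (m 2 * n 0 - m 0 * n 2) * (ε * m 2 * n 0 - m 0 * (ε * n 2)) +
      (m 0 * n 1 - m 1 * n 0) * (m 0 * n 1 - m 1 * n 0) = Real.sin θ ^ 2 := by
    have : coForm ε m m * coForm ε n n - coForm ε m n ^ 2 = Real.sin θ ^ 2 := by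
      rw [hm, hn, hmn]; linear_combination -Real.sin_sq_add_cos_sq θ
    rw [← this]; simp only [coForm]; ring
  simp only [pair] at h1 h2
  simp only [rotInvariant] at h3
  have hne := pow_ne_zero 2 hθ
  apply Subtype.ext
  funext i
  refine mul_left_cancel₀ hne ?_
  rw [← hdet]
  fin_cases i <;> simp only [Fin.zero_eta, Fin.mk_one, Fin.reduceFinMk]
  · linear_combination (m 1 * n 2 - m 2 * n 1) * h3 +
      (n 1 * (m 0 * n 1 - m 1 * n 0) - n 2 * (ε * m 2 * n 0 - m 0 * (ε * n 2))) * h1 -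
      (m 1 * (m 0 * n 1 - m 1 * n 0) - m 2 * (ε * m 2 * n 0 - m 0 * (ε * n 2))) * h2
  · linear_combination (m 2 * n 0 - m 0 * n 2) * h3 +
      (n 2 * (m 1 * (ε * n 2) - ε * m 2 * n 1) - n 0 * (m 0 * n 1 - m 1 * n 0)) * h1 -
      (m 2 * (m 1 * (ε * n 2) - ε * m 2 * n 1) - m 0 * (m 0 * n 1 - m 1 * n 0)) * h2
  · linear_combination (m 0 * n 1 - m 1 * n 0) * h3 +
      (n 0 * (ε * m 2 * n 0 - m 0 * (ε * n 2)) - n 1 * (m 1 * (ε * n 2) - ε * m 2 * n 1)) * h1 -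
      (m 0 * (ε * m 2 * n 0 - m 0 * (ε * n 2)) - m 1 * (m 1 * (ε * n 2) - ε * m 2 * n 1)) * h2

/-- The product of the two reflections acts as a rotation through `2θ` on the combinations of `m`
and `n`. -/
theorem pair_refl_mul_refl_pow {ε θ : ℝ} (m n : Fin 3 → ℝ) (hm : coForm ε m m = 1)
    (hn : coForm ε n n = 1) (hmn : coForm ε m n = -Real.cos θ) (k : ℕ) (x : Plane ε) :
    pair m (((refl m hm * refl n hn) ^ k) x).1 * Real.sin θ =
        -Real.sin ((2 * k - 1) * θ) * pair m x.1 - Real.sin (2 * k * θ) * pair n x.1 ∧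
      pair n (((refl m hm * refl n hn) ^ k) x).1 * Real.sin θ =
        Real.sin (2 * k * θ) * pair m x.1 + Real.sin ((2 * k + 1) * θ) * pair n x.1 := by
  have hnm : coForm ε n m = -Real.cos θ := by rw [← hmn]; simp only [coForm]; ring
  have hrec : ∀ x : ℝ, Real.sin ((x + 1) * θ) =
      2 * Real.cos θ * Real.sin (x * θ) - Real.sin ((x - 1) * θ) := fun x => by
    have h1 : (x + 1) * θ = x * θ + θ := by ring
    have h2 : (x - 1) * θ = x * θ - θ := by ring
    rw [h1, h2, Real.sin_add, Real.sin_sub]; ring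
  induction k with
  | zero => simp; constructor <;> ring
  | succ k ih =>
    obtain ⟨ih1, ih2⟩ := ih
    have e0 := hrec (2 * k)
    have e1 := hrec (2 * k + 1)
    have e2 := hrec (2 * k + 2)
    simp only [show (2 * k + 1 - 1 : ℝ) = 2 * k by ring,
      show (2 * k + 1 + 1 : ℝ) = 2 * k + 2 by ring,
      show (2 * k + 2 - 1 : ℝ) = 2 * k + 1 by ring] at e1 e2
    rw [pow_succ', Equiv.Perm.mul_apply, Equiv.Perm.mul_apply]
    simp only [pair_refl, hm, hn, hmn, hnm]
    simp only [Nat.cast_add, Nat.cast_one, show (2 * (k + 1 : ℝ)) = 2 * k + 2 by ring,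
      show (2 * k + 2 - 1 : ℝ) = 2 * k + 1 by ring]
    rw [e2, e1, e0]
    rw [e0] at ih2
    constructor
    · linear_combination -ih1 - 2 * Real.cos θ * ih2
    · linear_combination 2 * Real.cos θ * ih1 + (4 * Real.cos θ ^ 2 - 1) * ih2

/-- For `θ = π / k` the total angle `2kθ` is a full turn, so both pairings return to their values,
and `rotInvariant` never changes. -/
theorem refl_mul_refl_pow {ε : ℝ} (m n : Fin 3 → ℝ) (hm : coForm ε m m = 1)
    (hn : coForm ε n n = 1) {k : ℕ} (hk : 2 ≤ k) (hmn : coForm ε m n = -Real.cos (Real.pi / k)) :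
    (refl m hm * refl n hn) ^ k = 1 := by
  have hk' : (2 : ℝ) ≤ k := by exact_mod_cast hk
  have hk0 : (k : ℝ) ≠ 0 := by linarith
  have hθ : Real.sin (Real.pi / k) ≠ 0 :=
    (Real.sin_pos_of_pos_of_lt_pi (div_pos Real.pi_pos (by linarith))
      (div_lt_self Real.pi_pos (by linarith))).ne'
  have a1 : 2 * (k : ℝ) * (Real.pi / k) = 2 * Real.pi := by field_simp
  have a2 : (2 * (k : ℝ) - 1) * (Real.pi / k) = 2 * Real.pi - Real.pi / k := by field_simp
  have a3 : (2 * (k : ℝ) + 1) * (Real.pi / k) = Real.pi / k + 2 * Real.pi := by field_simp; ring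
  refine Equiv.ext fun x => ?_
  obtain ⟨h1, h2⟩ := pair_refl_mul_refl_pow m n hm hn hmn k x
  rw [a1, a2, Real.sin_two_pi, Real.sin_two_pi_sub] at h1
  rw [a1, a3, Real.sin_two_pi, Real.sin_add_two_pi] at h2
  refine eq_of_pair_eq_of_rotInvariant_eq m n hm hn hmn hθ
    (mul_right_cancel₀ hθ (by rw [h1]; simp; ring))
    (mul_right_cancel₀ hθ (by rw [h2]; simp; ring)) ?_
  have hinv : ∀ j : ℕ, rotInvariant ε m n (((refl m hm * refl n hn) ^ j) x).1 =
      rotInvariant ε m n x.1 := fun j => by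
    induction j with
    | zero => rfl
    | succ j ih => rw [pow_succ', Equiv.Perm.mul_apply, rotInvariant_refl_mul_refl, ih]
  exact hinv k

/-- The Coxeter matrix of the triangle group. -/
def coxeterMatrix (p q : ℕ) (hp : 3 ≤ p) (hq : 3 ≤ q) : CoxeterMatrix (Fin 3) where
  M := !![1, q, 2; q, 1, p; 2, p, 1]
  isSymm := by ext i j; fin_cases i <;> fin_cases j <;> rfl
  diagonal i := by fin_cases i <;> rfl
  off_diagonal i j h := by fin_cases i <;> fin_cases j <;> simp at h ⊢ <;> omega

variable {p q : ℕ}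

/-- The covectors of the sides of `F`. -/
def norms (p q : ℕ) : Fin 3 → Fin 3 → ℝ := ![normA, normB p q, normC]

theorem coForm_norms (hp : 3 ≤ p) (hq : 3 ≤ q) (i j : Fin 3) :
    coForm (curv p q) (norms p q i) (norms p q j) =
      -Real.cos (Real.pi / coxeterMatrix p q hp hq i j) := by
  have hsymm : ∀ m n, coForm (curv p q) m n = coForm (curv p q) n m := fun m n => by
    simp only [coForm]; ring
  obtain ⟨h1, h2, h3⟩ := coForm_angles p q
  fin_cases i <;> fin_cases j <;> simp only [norms, coxeterMatrix, Matrix.of_apply,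
    Matrix.cons_val, Fin.zero_eta, Fin.mk_one, Fin.reduceFinMk, Nat.cast_one, div_one,
    Real.cos_pi, neg_neg, coForm_normA, coForm_normB, coForm_normC, Nat.cast_ofNat]
  · exact h1
  · exact h2
  · rw [hsymm, h1]
  · exact h3
  · rw [hsymm, h2]
  · rw [hsymm, h3]

theorem coForm_norms_self (i : Fin 3) : coForm (curv p q) (norms p q i) (norms p q i) = 1 := by
  fin_cases i
  · exact coForm_normA _
  · exact coForm_normB p q
  · exact coForm_normC _

/-- The reflections `a`, `b`, `c`. -/
def gen (p q : ℕ) (i : Fin 3) : Equiv.Perm (X p q) := refl (norms p q i) (coForm_norms_self i)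

theorem coxeterMatrix_two_le (hp : 3 ≤ p) (hq : 3 ≤ q) {i j : Fin 3} (h : i ≠ j) :
    2 ≤ coxeterMatrix p q hp hq i j := by
  fin_cases i <;> fin_cases j <;> simp [coxeterMatrix] at h ⊢ <;> omega

theorem isLiftable_gen (hp : 3 ≤ p) (hq : 3 ≤ q) :
    (coxeterMatrix p q hp hq).IsLiftable (gen p q) := by
  intro i j
  by_cases h : i = j
  · subst h
    rw [CoxeterMatrix.diagonal, pow_one]
    exact refl_mul_refl _
  · exact refl_mul_refl_pow _ _ _ _ (coxeterMatrix_two_le hp hq h) (coForm_norms hp hq i j)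

/-- The action of the Coxeter group on the plane. -/
def action (hp : 3 ≤ p) (hq : 3 ≤ q) :
    (coxeterMatrix p q hp hq).Group →* Equiv.Perm (X p q) :=
  (coxeterMatrix p q hp hq).toCoxeterSystem.lift ⟨gen p q, isLiftable_gen hp hq⟩

theorem action_simple (hp : 3 ≤ p) (hq : 3 ≤ q) (i : Fin 3) :
    action hp hq ((coxeterMatrix p q hp hq).toCoxeterSystem.simple i) = gen p q i :=
  CoxeterSystem.lift_apply_simple _ _ i

theorem range_gen : Set.range (gen p q) = {a p q, b p q, c p q} := by
  ext g
  simp only [Set.mem_range, Fin.exists_fin_succ, Set.mem_insert_iff, Set.mem_singleton_iff,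
    eq_comm (b := g), or_false, IsEmpty.exists_iff]
  rfl

theorem range_action (hp : 3 ≤ p) (hq : 3 ≤ q) : (action hp hq).range = G p q := by
  rw [MonoidHom.range_eq_map,
    ← (coxeterMatrix p q hp hq).toCoxeterSystem.subgroup_closure_range_simple,
    MonoidHom.map_closure, ← Set.range_comp, G, ← range_gen]
  exact congrArg (fun f => Subgroup.closure (Set.range f)) (funext (action_simple hp hq))

/-- Tits' theorem with the pairings against the sides of `F` as simple roots: interior points of `F`
leave `F` under every nontrivial element. -/
theorem eq_one_of_action_mem (hp : 3 ≤ p) (hq : 3 ≤ q) {x : X p q}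
    (hx : ∀ i, 0 < pair (norms p q i) x.1) (w : (coxeterMatrix p q hp hq).Group)
    (hw : action hp hq w x ∈ F p q) : w = 1 := by
  refine (coxeterMatrix p q hp hq).toCoxeterSystem.eq_one_of_mem_chamber ?_ (action hp hq)
    (fun i y => pair (norms p q i) y.1) ?_ hx w ?_
  · intro i j
    by_cases h : i = j
    · subst h; simp
    · have := coxeterMatrix_two_le hp hq h; omega
  · intro i j y
    rw [action_simple, gen, pair_refl, coForm_norms hp hq]
    ring
  · obtain ⟨h0, h1, h2⟩ := hw
    intro i
    fin_cases i
    · exact h0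
    · exact h1
    · exact h2

/-! ### Triangles and group elements -/

theorem exists_interior_point (p q : ℕ) : ∃ x : X p q, ∀ i, 0 < pair (norms p q i) x.1 := by
  have hh : 0 < height p q := by
    unfold height
    split_ifs with h
    · exact one_pos
    · exact Real.sqrt_pos.2 (abs_pos.2 h)
  have hε : curv p q ≤ 1 := by
    unfold curv
    rcases Real.sign_apply_eq (gram p q) with h | h | h <;> rw [h] <;> norm_num
  -- The point lies near the right-angled vertex `(0, 0, 1)`. The bound `1/2` keeps the third
  -- coordinate at least `1/2`, and `height / 8` makes the loss of at most `2t` at the hypotenuse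
  -- smaller than `height / 2`.
  set t := min (1 / 2) (height p q / 8) with ht
  have ht0 : 0 < t := lt_min (by norm_num) (by linarith)
  have ht1 : t ≤ 1 / 2 := min_le_left _ _
  have ht2 : t ≤ height p q / 8 := min_le_right _ _
  have htt : t * t ≤ 1 / 4 := by nlinarith
  have hrad : 1 / 4 ≤ 1 - curv p q * (t ^ 2 + t ^ 2) := by
    have : curv p q * (t ^ 2 + t ^ 2) ≤ 1 * (t ^ 2 + t ^ 2) :=
      mul_le_mul_of_nonneg_right hε (by positivity)
    nlinarith
  have hz : 1 / 2 ≤ √(1 - curv p q * (t ^ 2 + t ^ 2)) := by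
    apply Real.le_sqrt_of_sq_le
    linarith
  refine ⟨⟨![t, t, √(1 - curv p q * (t ^ 2 + t ^ 2))], ?_, fun _ => ?_⟩, fun i => ?_⟩
  · simp only [Matrix.cons_val]
    rw [Real.sq_sqrt (by linarith)]; ring
  · simp only [Matrix.cons_val]; linarith
  · fin_cases i <;> simp [norms, normA, normB, normC, pair, ht0]
    have h1 := mul_le_mul_of_nonneg_right (Real.cos_le_one (Real.pi / q)) ht0.le
    have h2 := mul_le_mul_of_nonneg_right (Real.cos_le_one (Real.pi / p)) ht0.le
    have h3 := mul_le_mul_of_nonneg_left hz hh.le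
    linarith

/-- A triangle that lies in a union of triangles is one of them. -/
theorem mem_of_image_F_subset (hp : 3 ≤ p) (hq : 3 ≤ q) {g : Equiv.Perm (X p q)} (hg : g ∈ G p q)
    {D : Subgroup (Equiv.Perm (X p q))} (hD : D ≤ G p q)
    (h : g '' F p q ⊆ ⋃ w ∈ D, w '' F p q) : g ∈ D := by
  obtain ⟨x, hx⟩ := exists_interior_point p q
  have hxF : x ∈ F p q := ⟨(hx 0).le, (hx 1).le, (hx 2).le⟩
  obtain ⟨w, hw, y, hy, hyx⟩ := Set.mem_iUnion₂.1 (h ⟨x, hxF, rfl⟩)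
  obtain ⟨v, hv⟩ : w⁻¹ * g ∈ (action hp hq).range :=
    range_action hp hq ▸ mul_mem (inv_mem (hD hw)) hg
  have hvx : action hp hq v x = y := by
    rw [hv, Equiv.Perm.mul_apply, ← hyx]; simp
  have hv1 := eq_one_of_action_mem hp hq hx v (hvx ▸ hy)
  rw [hv1, map_one] at hv
  rwa [← inv_mul_eq_one.1 hv.symm]

/-- The case of the trivial subgroup in `mem_of_image_F_subset`. -/
theorem eq_of_image_F_eq (hp : 3 ≤ p) (hq : 3 ≤ q) {g g' : Equiv.Perm (X p q)} (hg : g ∈ G p q)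
    (hg' : g' ∈ G p q) (h : g '' F p q = g' '' F p q) : g = g' := by
  have : g'⁻¹ * g ∈ (⊥ : Subgroup (Equiv.Perm (X p q))) := by
    refine mem_of_image_F_subset hp hq (mul_mem (inv_mem hg') hg) bot_le ?_
    simp [Equiv.Perm.coe_mul, Set.image_comp, h, Set.image_image]
  exact (inv_mul_eq_one.1 (Subgroup.mem_bot.1 this)).symm

theorem action_injective (hp : 3 ≤ p) (hq : 3 ≤ q) : Function.Injective (action hp hq) := by
  obtain ⟨x, hx⟩ := exists_interior_point p q
  refine (injective_iff_map_eq_one _).2 fun w hw => eq_one_of_action_mem hp hq hx w ?_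
  rw [hw]
  exact ⟨(hx 0).le, (hx 1).le, (hx 2).le⟩

/-! ### Rotations and words of even length -/

theorem gen_mul_gen_mem_rotG (i j : Fin 3) : gen p q i * gen p q j ∈ rotG p q := by
  have hinv : ∀ i, (gen p q i)⁻¹ = gen p q i := fun i =>
    inv_eq_of_mul_eq_one_left (refl_mul_refl _)
  have h0 : ∀ i, gen p q 0 * gen p q i ∈ rotG p q := by
    intro i
    fin_cases i
    · have : gen p q 0 * gen p q 0 = 1 := refl_mul_refl _
      simp [this, one_mem]
    · exact (ab p q).2
    · exact (ac p q).2
  have := mul_mem (inv_mem (h0 i)) (h0 j)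
  rwa [mul_inv_rev, hinv i, hinv 0, mul_assoc, ← mul_assoc (gen p q 0) (gen p q 0),
    show gen p q 0 * gen p q 0 = 1 from refl_mul_refl _, one_mul] at this

theorem gen_notMem_rotG (hp : 3 ≤ p) (hq : 3 ≤ q) (i : Fin 3) : gen p q i ∉ rotG p q := by
  set cs := (coxeterMatrix p q hp hq).toCoxeterSystem with hcs
  -- Rotations come from words of even length. Since the action is faithful, a generator comes only
  -- from itself, which is odd.
  have hle : rotG p q ≤ cs.lengthParity.ker.map (action hp hq) := by
    have hmem : ∀ i j, gen p q i * gen p q j ∈ cs.lengthParity.ker.map (action hp hq) :=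
      fun i j => ⟨cs.simple i * cs.simple j, by
        show cs.lengthParity _ = 1
        rw [map_mul, cs.lengthParity_simple, cs.lengthParity_simple]; decide,
        by rw [map_mul, hcs, action_simple, action_simple]⟩
    rw [rotG, Subgroup.closure_le]
    rintro _ (rfl | rfl)
    · exact hmem 0 1
    · exact hmem 0 2
  intro h
  obtain ⟨w, hw, hwi⟩ := hle h
  rw [← action_simple hp hq] at hwi
  rw [action_injective hp hq hwi] at hw
  have : cs.lengthParity (cs.simple i) = 1 := hw
  rw [cs.lengthParity_simple] at this
  exact absurd this (by decide)

end RegTiling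
end

noncomputable section

namespace RegTiling

variable {p q : ℕ}

/-! ### Coset colourings -/

theorem gen_mul_self (i : Fin 3) : gen p q i * gen p q i = 1 := refl_mul_refl _

theorem gen_mem_G (i : Fin 3) : gen p q i ∈ G p q := by
  rw [G, ← range_gen]
  exact Subgroup.subset_closure ⟨i, rfl⟩

theorem rotG_le_G : rotG p q ≤ G p q := by
  rw [rotG, Subgroup.closure_le]
  rintro _ (rfl | rfl)
  · exact mul_mem (gen_mem_G 0) (gen_mem_G 1)
  · exact mul_mem (gen_mem_G 0) (gen_mem_G 2)

theorem closure_pair_le_G (i j : Fin 3) :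
    Subgroup.closure {gen p q i, gen p q j} ≤ G p q := by
  rw [Subgroup.closure_le]
  rintro _ (rfl | rfl) <;> exact gen_mem_G _

theorem mem_rotG_or_mul_gen_mem_rotG (i : Fin 3) {g : Equiv.Perm (X p q)} (hg : g ∈ G p q) :
    g ∈ rotG p q ∨ g * gen p q i ∈ rotG p q := by
  have step : ∀ (g : Equiv.Perm (X p q)) (j : Fin 3),
      (g ∈ rotG p q ∨ g * gen p q i ∈ rotG p q) →
        (g * gen p q j ∈ rotG p q ∨ g * gen p q j * gen p q i ∈ rotG p q) := by
    rintro g j (h | h)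
    · exact Or.inr (mul_assoc g _ _ ▸ mul_mem h (gen_mul_gen_mem_rotG j i))
    · left
      have := mul_mem h (gen_mul_gen_mem_rotG i j)
      rwa [mul_assoc, ← mul_assoc (gen p q i), gen_mul_self, one_mul] at this
  rw [G, ← range_gen] at hg
  induction hg using Subgroup.closure_induction_right with
  | one => exact Or.inl (one_mem _)
  | mul_right x _ y hy ih => obtain ⟨j, rfl⟩ := hy; exact step x j ih
  | mul_inv_cancel x _ y hy ih =>
    obtain ⟨j, rfl⟩ := hy
    rw [inv_eq_of_mul_eq_one_left (gen_mul_self j)]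
    exact step x j ih

theorem mul_gen_mem_rotG_iff (hp : 3 ≤ p) (hq : 3 ≤ q) (i : Fin 3) {g : Equiv.Perm (X p q)}
    (hg : g ∈ G p q) : g * gen p q i ∈ rotG p q ↔ g ∉ rotG p q := by
  refine ⟨fun h h' => gen_notMem_rotG hp hq i ?_, (mem_rotG_or_mul_gen_mem_rotG i hg).resolve_left⟩
  exact (Subgroup.mul_mem_cancel_left _ h').1 h

open Classical in
/-- The left coset of `S` that gives the colour of the triangle `g F`, with respect to the
fundamental domain `F ∪ r F` of the rotation group. -/
def cosetOf (S : Subgroup (rotG p q)) (r g : Equiv.Perm (X p q)) : rotG p q ⧸ S :=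
  if h : g ∈ rotG p q then ((⟨g, h⟩ : rotG p q) : rotG p q ⧸ S)
  else if h : g * r ∈ rotG p q then ((⟨g * r, h⟩ : rotG p q) : rotG p q ⧸ S)
  -- A default value, never reached for `g ∈ G` and `r` a generator.
  else ((1 : rotG p q) : rotG p q ⧸ S)

section

variable (S : Subgroup (rotG p q)) {g : Equiv.Perm (X p q)}

theorem cosetOf_of_mem (r : Equiv.Perm (X p q)) (h : g ∈ rotG p q) :
    cosetOf S r g = ((⟨g, h⟩ : rotG p q) : rotG p q ⧸ S) := dif_pos h

theorem cosetOf_of_mul_mem (hp : 3 ≤ p) (hq : 3 ≤ q) (i : Fin 3) (hg : g ∈ G p q)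
    (h : g * gen p q i ∈ rotG p q) :
    cosetOf S (gen p q i) g = ((⟨g * gen p q i, h⟩ : rotG p q) : rotG p q ⧸ S) := by
  rw [cosetOf, dif_neg ((mul_gen_mem_rotG_iff hp hq i hg).1 h), dif_pos h]

theorem cosetOf_mul_left (hp : 3 ≤ p) (hq : 3 ≤ q) (i : Fin 3) (h : rotG p q) (hg : g ∈ G p q) :
    cosetOf S (gen p q i) (h.1 * g) = h • cosetOf S (gen p q i) g := by
  rcases mem_rotG_or_mul_gen_mem_rotG i hg with hr | hr
  · rw [cosetOf_of_mem S _ hr, cosetOf_of_mem S _ (mul_mem h.2 hr)]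
    rfl
  · have hr' : h.1 * g * gen p q i ∈ rotG p q := by
      rw [mul_assoc]; exact mul_mem h.2 hr
    rw [cosetOf_of_mul_mem S hp hq i hg hr,
      cosetOf_of_mul_mem S hp hq i (mul_mem (rotG_le_G h.2) hg) hr']
    rfl

/-- Crossing the side of `s_j` changes the representing rotation by the right factor `s_j s_i` or
its inverse, which `S` absorbs. -/
theorem cosetOf_mul_gen (hp : 3 ≤ p) (hq : 3 ≤ q) (i j : Fin 3)
    (hS : (⟨gen p q j * gen p q i, gen_mul_gen_mem_rotG j i⟩ : rotG p q) ∈ S) (hg : g ∈ G p q) :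
    cosetOf S (gen p q i) (g * gen p q j) = cosetOf S (gen p q i) g := by
  have hgj : g * gen p q j ∈ G p q := mul_mem hg (gen_mem_G j)
  by_cases hr : g ∈ rotG p q
  · have hr' : g * gen p q j * gen p q i ∈ rotG p q :=
      mul_assoc g _ _ ▸ mul_mem hr (gen_mul_gen_mem_rotG j i)
    rw [cosetOf_of_mem S _ hr, cosetOf_of_mul_mem S hp hq i hgj hr', eq_comm, QuotientGroup.eq]
    convert hS using 1
    apply Subtype.ext
    simp [mul_assoc]
  · have hri := (mul_gen_mem_rotG_iff hp hq i hg).2 hr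
    have hrj := (mul_gen_mem_rotG_iff hp hq j hg).2 hr
    rw [cosetOf_of_mem S _ hrj, cosetOf_of_mul_mem S hp hq i hg hri, QuotientGroup.eq]
    convert hS using 1
    apply Subtype.ext
    simp [mul_assoc, inv_eq_of_mul_eq_one_left (gen_mul_self (p := p) (q := q) j)]

theorem cosetOf_mul_of_mem_closure (hp : 3 ≤ p) (hq : 3 ≤ q) (i j : Fin 3)
    (hS : (⟨gen p q j * gen p q i, gen_mul_gen_mem_rotG j i⟩ : rotG p q) ∈ S) (hg : g ∈ G p q)
    {w : Equiv.Perm (X p q)} (hw : w ∈ Subgroup.closure {gen p q i, gen p q j}) :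
    cosetOf S (gen p q i) (g * w) = cosetOf S (gen p q i) g := by
  have hii : (⟨gen p q i * gen p q i, gen_mul_gen_mem_rotG i i⟩ : rotG p q) ∈ S := by
    convert one_mem S using 1
    exact Subtype.ext (gen_mul_self i)
  have step : ∀ w ∈ Subgroup.closure {gen p q i, gen p q j}, ∀ y ∈ ({gen p q i, gen p q j} : Set _),
      cosetOf S (gen p q i) (g * (w * y)) = cosetOf S (gen p q i) (g * w) := by
    intro w hw y hy
    have hgw : g * w ∈ G p q := mul_mem hg (closure_pair_le_G i j hw)
    rw [← mul_assoc]
    rcases hy with rfl | rfl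
    · exact cosetOf_mul_gen S hp hq i i hii hgw
    · exact cosetOf_mul_gen S hp hq i j hS hgw
  induction hw using Subgroup.closure_induction_right with
  | one => rw [mul_one]
  | mul_right x hx y hy ih => rw [step x hx y hy, ih]
  | mul_inv_cancel x hx y hy ih =>
    have : y⁻¹ = y := by
      rcases hy with rfl | rfl <;> exact inv_eq_of_mul_eq_one_left (gen_mul_self _)
    rw [this, step x hx y hy, ih]

end

/-! ### Monochromatic tiles and perfect colourings -/

theorem polygon_subset {r s w : Equiv.Perm (X p q)} (hw : w ∈ Subgroup.closure {r, s}) :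
    w '' F p q ⊆ polygon p q r s :=
  Set.subset_biUnion_of_mem (u := fun w : Equiv.Perm (X p q) => w '' F p q) hw

theorem inv_mul_mem_of_image_F_subset (hp : 3 ≤ p) (hq : 3 ≤ q) (i j : Fin 3)
    {g g' : Equiv.Perm (X p q)} (hg : g ∈ G p q) (hg' : g' ∈ G p q)
    (h : g '' F p q ⊆ g' '' polygon p q (gen p q i) (gen p q j)) :
    g'⁻¹ * g ∈ Subgroup.closure {gen p q i, gen p q j} := by
  refine mem_of_image_F_subset hp hq (mul_mem (inv_mem hg') hg) (closure_pair_le_G i j) ?_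
  rintro _ ⟨x, hx, rfl⟩
  obtain ⟨y, hy, hyx⟩ := h ⟨x, hx, rfl⟩
  rw [Equiv.Perm.mul_apply, ← hyx]
  simpa [polygon] using hy

theorem exists_numbering {k : ℕ} (hk : k ≠ 0) (S : Subgroup (rotG p q)) (hS : S.index = k) :
    ∃ e : (rotG p q ⧸ S) ≃ Fin k, (e ((1 : rotG p q) : rotG p q ⧸ S) : ℕ) = 0 := by
  have hcard : Nat.card (rotG p q ⧸ S) = k := hS
  -- An infinite index would be recorded as `0`.
  have : Finite (rotG p q ⧸ S) := Nat.finite_of_card_ne_zero (hcard ▸ hk)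
  have e := (Finite.equivFinOfCardEq hcard)
  -- The swap gives the coset `S` itself the number `0`.
  refine ⟨e.trans (Equiv.swap (e ((1 : rotG p q) : rotG p q ⧸ S)) ⟨0, Nat.pos_of_ne_zero hk⟩), ?_⟩
  simp

theorem mem_of_inducesPerfect {k : ℕ} {S : Subgroup (rotG p q)} {i j : Fin 3}
    (h : InducesPerfect S (gen p q i) k (tilingOf p q (gen p q i) (gen p q j))) :
    (⟨gen p q j * gen p q i, gen_mul_gen_mem_rotG j i⟩ : rotG p q) ∈ S := by
  obtain ⟨γ, col, ⟨e, -, hγ⟩, hcol, -⟩ := h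
  let t : tilingOf p q (gen p q i) (gen p q j) :=
    ⟨polygon p q (gen p q i) (gen p q j), 1, one_mem _, by simp⟩
  let Δ : triangles p q := ⟨F p q, 1, one_mem _, by simp⟩
  let Δ' : triangles p q := ⟨gen p q j '' F p q, _, gen_mem_G j, rfl⟩
  have h1 := hcol t Δ (by simpa using polygon_subset (p := p) (q := q) (one_mem _))
  have h2 := hcol t Δ' (polygon_subset (Subgroup.subset_closure (Or.inr rfl)))
  rw [hγ 1 Δ (Or.inl (by simp [Δ]))] at h1
  -- With `r = s_i`, the triangle `s_j F` is `f r F` for the rotation `f = s_j s_i`, while `F` has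
  -- the colour of `S`.
  rw [hγ ⟨gen p q j * gen p q i, gen_mul_gen_mem_rotG j i⟩ Δ' (Or.inr (by
    rw [← Set.image_comp, ← Equiv.Perm.coe_mul, mul_assoc, gen_mul_self, mul_one]))] at h2
  have h3 := QuotientGroup.eq.1 (e.injective (h1.symm.trans h2))
  simpa using h3

theorem inducesPerfect_of_mem (hp : 3 ≤ p) (hq : 3 ≤ q) {k : ℕ} (hk : k ≠ 0)
    {S : Subgroup (rotG p q)} (hS : S.index = k) {i j : Fin 3}
    (h : (⟨gen p q j * gen p q i, gen_mul_gen_mem_rotG j i⟩ : rotG p q) ∈ S) :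
    InducesPerfect S (gen p q i) k (tilingOf p q (gen p q i) (gen p q j)) := by
  obtain ⟨e, he⟩ := exists_numbering hk S hS
  set ρ := cosetOf S (gen p q i) with hρ
  choose τ hτG hτ using fun Δ : triangles p q => Δ.2
  choose σ hσG hσ using fun t : tilingOf p q (gen p q i) (gen p q j) => t.2
  have hsub : ∀ (t : tilingOf p q (gen p q i) (gen p q j)) (g : Equiv.Perm (X p q)), g ∈ G p q →
      g '' F p q ⊆ t.1 → ρ (σ t) = ρ g := by
    intro t g hg hgt
    rw [hσ t] at hgt
    have := cosetOf_mul_of_mem_closure S hp hq i j h (hσG t)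
      (inv_mul_mem_of_image_F_subset hp hq i j hg (hσG t) hgt)
    rw [mul_inv_cancel_left] at this
    exact this.symm
  -- A tile is `g` times the polygon for many `g`; the colour does not depend on the chosen `σ t`.
  have htile : ∀ (t : tilingOf p q (gen p q i) (gen p q j)) (g : Equiv.Perm (X p q)), g ∈ G p q →
      t.1 = g '' polygon p q (gen p q i) (gen p q j) → ρ (σ t) = ρ g := by
    intro t g hg hgt
    refine hsub t g hg ?_
    rw [hgt]
    exact Set.image_mono (by simpa using polygon_subset (p := p) (q := q) (one_mem _))
  refine ⟨fun Δ => e (ρ (τ Δ)), fun t => e (ρ (σ t)), ⟨e, he, ?_⟩, ?_, ?_, ?_⟩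
  · rintro f Δ (hΔ | hΔ)
    · have : τ Δ = f.1 := eq_of_image_F_eq hp hq (hτG Δ) (rotG_le_G f.2) (by rw [← hτ, hΔ])
      simp only [this]
      rw [hρ, cosetOf_of_mem S _ f.2]
    · have hf : f.1 * gen p q i ∈ G p q := mul_mem (rotG_le_G f.2) (gen_mem_G i)
      have : τ Δ = f.1 * gen p q i := eq_of_image_F_eq hp hq (hτG Δ) hf
        (by rw [← hτ, hΔ, Equiv.Perm.coe_mul, Set.image_comp])
      have hfi : f.1 * gen p q i * gen p q i = f.1 := by rw [mul_assoc, gen_mul_self, mul_one]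
      simp only [this]
      rw [hρ, cosetOf_of_mul_mem S hp hq i hf (by rw [hfi]; exact f.2)]
      simp only [hfi]
  · intro t Δ hΔ
    exact congrArg e (hsub t (τ Δ) (hτG Δ) (hτ Δ ▸ hΔ))
  · intro n
    obtain ⟨f, hf⟩ := QuotientGroup.mk_surjective (e.symm n)
    refine ⟨⟨_, f.1, rotG_le_G f.2, rfl⟩, ?_⟩
    show e _ = n
    rw [htile _ f.1 (rotG_le_G f.2) rfl, hρ, cosetOf_of_mem S _ f.2, ← e.eq_symm_apply]
    exact hf
  · intro g hg
    -- The colour permutation is left multiplication by `g` on the cosets, read through the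
    -- numbering `e`.
    refine ⟨(e.symm.trans (MulAction.toPerm (⟨g, hg⟩ : rotG p q))).trans e, fun t => ?_⟩
    have himg : g '' t.1 = (g * σ t) '' polygon p q (gen p q i) (gen p q j) := by
      rw [Equiv.Perm.coe_mul, Set.image_comp, ← hσ t]
    have hgG : g * σ t ∈ G p q := mul_mem (rotG_le_G hg) (hσG t)
    refine ⟨⟨_, hgG, himg⟩, ?_⟩
    show e _ = _
    rw [htile _ _ hgG himg, hρ, cosetOf_mul_left S hp hq i ⟨g, hg⟩ (hσG t)]
    simp

theorem inducesPerfect_iff (hp : 3 ≤ p) (hq : 3 ≤ q) {k : ℕ} (hk : k ≠ 0)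
    {S : Subgroup (rotG p q)} (hS : S.index = k) (i j : Fin 3) :
    InducesPerfect S (gen p q i) k (tilingOf p q (gen p q i) (gen p q j)) ↔
      (⟨gen p q j * gen p q i, gen_mul_gen_mem_rotG j i⟩ : rotG p q) ∈ S :=
  ⟨mem_of_inducesPerfect, inducesPerfect_of_mem hp hq hk hS⟩

/-- A tile of `tilingOf p q (gen p q i) (gen p q j)` is monochromatic by way of either of the two
reflections exactly if the rotation about its centre lies in `S`. -/
theorem inducesPerfect_iff_of_mem_pair (hp : 3 ≤ p) (hq : 3 ≤ q) {k : ℕ} (hk : k ≠ 0)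
    {S : Subgroup (rotG p q)} (hS : S.index = k) (i j : Fin 3) :
    ∀ r ∈ ({gen p q i, gen p q j} : Set (Equiv.Perm (X p q))),
      (InducesPerfect S r k (tilingOf p q (gen p q i) (gen p q j)) ↔
        (⟨gen p q i * gen p q j, gen_mul_gen_mem_rotG i j⟩ : rotG p q) ∈ S) := by
  rintro r (rfl | rfl)
  · rw [inducesPerfect_iff hp hq hk hS, ← inv_mem_iff]
    have hinv : ∀ i, (gen p q i)⁻¹ = gen p q i := fun i =>
      inv_eq_of_mul_eq_one_left (gen_mul_self i)
    have : (⟨gen p q j * gen p q i, gen_mul_gen_mem_rotG j i⟩ : rotG p q)⁻¹ =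
        ⟨gen p q i * gen p q j, gen_mul_gen_mem_rotG i j⟩ :=
      Subtype.ext (by simp [hinv])
    rw [this]
  -- The tiling is symmetric in the two reflections, so the roles of `i` and `j` may be exchanged.
  · have : tilingOf p q (gen p q i) (gen p q j) = tilingOf p q (gen p q j) (gen p q i) := by
      simp only [tilingOf, polygon, Set.pair_comm (gen p q i)]
    rw [this, inducesPerfect_iff hp hq hk hS]

end RegTiling
end

theorem mainTheorem2 (p q : ℕ) (hp : 3 ≤ p) (hq : 3 ≤ q) (k : ℕ) (hk : k ≠ 0)
    (S : Subgroup (RegTiling.rotG p q)) (hS : S.index = k) :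
    (∀ r ∈ ({RegTiling.a p q, RegTiling.b p q} : Set (Equiv.Perm (RegTiling.X p q))),
      (RegTiling.InducesPerfect S r k (RegTiling.tilingQP p q) ↔ RegTiling.ab p q ∈ S)) ∧
    (∀ r ∈ ({RegTiling.a p q, RegTiling.c p q} : Set (Equiv.Perm (RegTiling.X p q))),
      (RegTiling.InducesPerfect S r k (RegTiling.tilingLaves p q) ↔ RegTiling.ac p q ∈ S)) ∧
    (∀ r ∈ ({RegTiling.b p q, RegTiling.c p q} : Set (Equiv.Perm (RegTiling.X p q))),
      (RegTiling.InducesPerfect S r k (RegTiling.tilingPQ p q) ↔ RegTiling.bc p q ∈ S)) :=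
  ⟨RegTiling.inducesPerfect_iff_of_mem_pair hp hq hk hS 0 1,
    RegTiling.inducesPerfect_iff_of_mem_pair hp hq hk hS 0 2,
    RegTiling.inducesPerfect_iff_of_mem_pair hp hq hk hS 1 2⟩
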